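/- Let $\mathcal A'$, $\mathcal A$, $\mathcal A''$ be abelian categories, each with enough projective and enough injective objects, and let $(\mathcal A',\mathcal A,\mathcal A'',i^*,i_*,i^!,j_!,j^*,j_*)$ be a recollement: functors $i_*:\mathcal A'\to\mathcal A$, $i^*,i^!:\mathcal A\to\mathcal A'$, $j^*:\mathcal A\to\mathcal A''$, $j_!,j_*:\mathcal A''\to\mathcal A$ such that $(i^*,i_*)$, $(i_*,i^!)$, $(j_!,j^*)$, $(j^*,j_*)$ are adjoint pairs, $i_*$, $j_!$, $j_*$ are fully faithful, and $\operatorname{Ker} j^*=\operatorname{Im} i_*$ (the essential image). Write $\mathbb L_1$ and $\mathbb R_1$ for first left and right derived functors. A pair $(\mathcal C,\mathcal D)$ of classes of objects in an abelian category is a *cotorsion pair* if $\mathcal D=\{X:\operatorname{Ext}^1(C,X)=0\ \text{for all } C\in\mathcal C\}$ and $\mathcal C=\{X:\operatorname{Ext}^1(X,D)=0\ \text{for all } D\in\mathcal D\}$. It is *complete* if for each object $M$ there are short exact sequences $0\to D_1\to C_1\to M\to 0$ and $0\to M\to D_2\to C_2\to 0$ with $C_1,C_2\in\mathcal C$ and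 $D_1,D_2\in\mathcal D$. It is *hereditary* if $\mathcal C$ is closed under kernels of epimorphisms and $\mathcal D$ is closed under cokernels of monomorphisms. For classes of objects $\mathcal X$ in $\mathcal A'$ and $\mathcal Y$ in $\mathcal A''$ put $$\mathcal M^{\mathcal X}_{\mathcal Y}=\{Z\in\mathcal A: i^*Z\in\mathcal X,\ j^*Z\in\mathcal Y,\ (\mathbb L_1 i^*)(Z)=0\},$$ $$\mathcal N^{\mathcal X}_{\mathcal Y}=\{Z\in\mathcal A: i^!Z\in\mathcal X,\ j^*Z\in\mathcal Y,\ (\mathbb R_1 i^!)(Z)=0\}.$$ Let $(\mathcal U',\mathcal V')$ and $(\mathcal U'',\mathcal V'')$ be complete hereditary cotorsion pairs in $\mathcal A'$ and $\mathcal A''$, respectively. Then $(\mathcal M^{\mathcal U'}_{\mathcal U''},\mathcal N^{\mathcal V'}_{\mathcal V''})$ is a complete hereditary cotorsion pair in $\mathcal A$ if one of the following conditions holds: 1. $i^!$ is exact and $(\mathbb L_1 j_!)(U)=0$ for all $U\in\mathcal U''$; 2. $i^*$ is exact and $(\mathbb R_1 j_*)(V)=0$ for all $V\in\mathcal V''$;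 3. both $i^!$ and $i^*$ are exact. -/

import Mathlib

open CategoryTheory CategoryTheory.Limits

universe v₁ v₂ v₃ v u₁ u₂ u₃ u

noncomputable section

/-- A recollement of the abelian category `A` relative to `A'` and `A''`:
the six functors `i^*`, `i_*`, `i^!`, `j_!`, `j^*`, `j_*` with the adjunctions
`i^* ⊣ i_* ⊣ i^!` and `j_! ⊣ j^* ⊣ j_*`, with `i_*`, `j_!`, `j_*` fully faithful, and
with `Ker j^* = Im i_*`. -/
structure Recollement (A' : Type u₁) [Category.{v₁} A'] [Abelian A']
    (A : Type u₂) [Category.{v₂} A] [Abelian A]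
    (A'' : Type u₃) [Category.{v₃} A''] [Abelian A''] where
  /-- `i^*` -/
  iUpperStar : A ⥤ A'
  /-- `i_*` -/
  iLowerStar : A' ⥤ A
  /-- `i^!` -/
  iUpperShriek : A ⥤ A'
  /-- `j_!` -/
  jLowerShriek : A'' ⥤ A
  /-- `j^*` -/
  jUpperStar : A ⥤ A''
  /-- `j_*` -/
  jLowerStar : A'' ⥤ A
  adj_iUpperStar_iLowerStar : iUpperStar ⊣ iLowerStar
  adj_iLowerStar_iUpperShriek : iLowerStar ⊣ iUpperShriek
  adj_jLowerShriek_jUpperStar : jLowerShriek ⊣ jUpperStar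
  adj_jUpperStar_jLowerStar : jUpperStar ⊣ jLowerStar
  iLowerStar_full : iLowerStar.Full
  iLowerStar_faithful : iLowerStar.Faithful
  jLowerShriek_full : jLowerShriek.Full
  jLowerShriek_faithful : jLowerShriek.Faithful
  jLowerStar_full : jLowerStar.Full
  jLowerStar_faithful : jLowerStar.Faithful
  /-- The kernel of `j^*` is the (essential) image of `i_*`. -/
  isZero_jUpperStar_obj_iff (X : A) : IsZero (jUpperStar.obj X) ↔ iLowerStar.essImage X

namespace Recollement

variable {A' : Type u₁} [Category.{v₁} A'] [Abelian A']
  {A : Type u₂} [Category.{v₂} A] [Abelian A]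
  {A'' : Type u₃} [Category.{v₃} A''] [Abelian A'']

/-! A functor between abelian categories with a left or a right adjoint is additive, so that
its derived functors make sense. -/

instance additive_iUpperStar (R : Recollement A' A A'') : R.iUpperStar.Additive := by
  have := R.adj_iUpperStar_iLowerStar.leftAdjoint_preservesColimits
  have := preservesBinaryBiproducts_of_preservesBinaryCoproducts R.iUpperStar
  exact Functor.additive_of_preservesBinaryBiproducts _

instance additive_iUpperShriek (R : Recollement A' A A'') : R.iUpperShriek.Additive := by
  have := R.adj_iLowerStar_iUpperShriek.rightAdjoint_preservesLimits
  exact Functor.additive_of_preserves_binary_products _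

instance additive_jLowerShriek (R : Recollement A' A A'') : R.jLowerShriek.Additive := by
  have := R.adj_jLowerShriek_jUpperStar.leftAdjoint_preservesColimits
  have := preservesBinaryBiproducts_of_preservesBinaryCoproducts R.jLowerShriek
  exact Functor.additive_of_preservesBinaryBiproducts _

instance additive_jLowerStar (R : Recollement A' A A'') : R.jLowerStar.Additive := by
  have := R.adj_jUpperStar_jLowerStar.rightAdjoint_preservesLimits
  exact Functor.additive_of_preserves_binary_products _

/-- The class `M^X_Y` of all `Z` in `A` with `i^* Z ∈ X`, `j^* Z ∈ Y` and
`(L₁ i^*)(Z) = 0`. -/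
def classM [EnoughProjectives A] (R : Recollement A' A A'')
    (X : ObjectProperty A') (Y : ObjectProperty A'') : ObjectProperty A :=
  fun Z => X (R.iUpperStar.obj Z) ∧ Y (R.jUpperStar.obj Z) ∧
    IsZero ((R.iUpperStar.leftDerived 1).obj Z)

/-- The class `N^X_Y` of all `Z` in `A` with `i^! Z ∈ X`, `j^* Z ∈ Y` and
`(R₁ i^!)(Z) = 0`. -/
def classN [EnoughInjectives A] (R : Recollement A' A A'')
    (X : ObjectProperty A') (Y : ObjectProperty A'') : ObjectProperty A :=
  fun Z => X (R.iUpperShriek.obj Z) ∧ Y (R.jUpperStar.obj Z) ∧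
    IsZero ((R.iUpperShriek.rightDerived 1).obj Z)

end Recollement

section Cotorsion

variable {C : Type u} [Category.{v} C] [Abelian C]

/-- `Ext¹(X, Y) = 0`. Enough projectives only serve to make the group live in the universe of
the morphisms. -/
def ExtOneVanishes [EnoughProjectives C] (X Y : C) : Prop :=
  haveI : HasExt.{v} C := hasExt_of_enoughProjectives.{v} C
  Subsingleton (Abelian.Ext.{v} X Y 1)

/-- The class of all `Y` with `Ext¹(X, Y) = 0` for every `X` in the given class. -/
def extRightPerp [EnoughProjectives C] (P : ObjectProperty C) : ObjectProperty C :=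
  fun Y => ∀ X, P X → ExtOneVanishes X Y

/-- The class of all `X` with `Ext¹(X, Y) = 0` for every `Y` in the given class. -/
def extLeftPerp [EnoughProjectives C] (Q : ObjectProperty C) : ObjectProperty C :=
  fun X => ∀ Y, Q Y → ExtOneVanishes X Y

/-- `(P, Q)` is a cotorsion pair. -/
structure IsCotorsionPair [EnoughProjectives C] (P Q : ObjectProperty C) : Prop where
  rightPerp_eq : extRightPerp P = Q
  leftPerp_eq : extLeftPerp Q = P

/-- Completeness of a pair of classes `(P, Q)`: each object `M` sits in short exact sequences
`0 → D₁ → C₁ → M → 0` and `0 → M → D₂ → C₂ → 0` with `C₁, C₂` in `P` and `D₁, D₂` in `Q`. -/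
structure IsCompletePair (P Q : ObjectProperty C) : Prop where
  exists_left (M : C) : ∃ (D₁ C₁ : C) (f : D₁ ⟶ C₁) (g : C₁ ⟶ M) (w : f ≫ g = 0),
    (ShortComplex.mk f g w).ShortExact ∧ P C₁ ∧ Q D₁
  exists_right (M : C) : ∃ (D₂ C₂ : C) (f : M ⟶ D₂) (g : D₂ ⟶ C₂) (w : f ≫ g = 0),
    (ShortComplex.mk f g w).ShortExact ∧ P C₂ ∧ Q D₂

/-- Heredity of a pair of classes `(P, Q)`: `P` is closed under kernels of epimorphisms and
`Q` is closed under cokernels of monomorphisms. -/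
structure IsHereditaryPair (P Q : ObjectProperty C) : Prop where
  kernel_mem (S : ShortComplex C) (hS : S.ShortExact) (h₂ : P S.X₂) (h₃ : P S.X₃) : P S.X₁
  cokernel_mem (S : ShortComplex C) (hS : S.ShortExact) (h₁ : Q S.X₁) (h₂ : Q S.X₂) : Q S.X₃

/-- `(P, Q)` is a complete hereditary cotorsion pair. -/
structure IsCompleteHereditaryCotorsionPair [EnoughProjectives C]
    (P Q : ObjectProperty C) : Prop where
  isCotorsionPair : IsCotorsionPair P Q
  isComplete : IsCompletePair P Q
  isHereditary : IsHereditaryPair P Q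

end Cotorsion

end

/-! Assume condition 1. Exactness of i^! makes j_* exact and gives 0 → i_* i^! W → W → j_* j^* W → 0
for every W. By adjunction, Ext¹(Z, i_* i^! W) embeds in Ext¹(i^* Z, i^! W) once L₁i^* vanishes at
Z, and Ext¹(Z, j_* j^* W) embeds in Ext¹(j^* Z, j^* W). Hence M and N are orthogonal. Conversely,
i_* U' and j_! U'' lie in M, i_* V' and j_* V'' lie in N, and orthogonality to these test objects
gives back the defining conditions (`isSplitCotorsionPair`). Right approximations are glued by two
pushouts, one correcting j^* and the next correcting i^! (`exists_right_approximation`). Salce's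
argument then gives left approximations, and heredity needs checking only for N. Condition 2 is
condition 1 for the opposite recollement, and under condition 3 exactness of i^* makes j_! exact,
which is enough for condition 1. To make this duality cheap, Ext¹ is replaced by splitting of
extensions (`extOneVanishes_iff`), and vanishing of first derived functors by preservation of
certain monomorphisms or epimorphisms (`isZero_leftDerived_one_iff`, `isZero_rightDerived_one_iff`).
-/

/-! ### Vanishing of Ext¹ as splitting of extensions. -/

section Extensions

variable {C : Type u} [Category.{v} C] [Abelian C]

/-- Every extension of `X` by `Y` splits. -/
def ExtensionsSplit (X Y : C) : Prop :=
  ∀ ⦃E : C⦄ (f : Y ⟶ E) (g : E ⟶ X) (w : f ≫ g = 0),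
    (ShortComplex.mk f g w).ShortExact → ∃ r : E ⟶ Y, f ≫ r = 𝟙 Y

lemma CategoryTheory.ShortComplex.ShortExact.exists_retraction_iff_exists_section
    {S : ShortComplex C} (hS : S.ShortExact) :
    (∃ r : S.X₂ ⟶ S.X₁, S.f ≫ r = 𝟙 _) ↔ ∃ s : S.X₃ ⟶ S.X₂, s ≫ S.g = 𝟙 _ := by
  have := hS.mono_f
  have := hS.epi_g
  constructor
  · rintro ⟨r, hr⟩
    exact ⟨_, (ShortComplex.Splitting.ofExactOfRetraction S hS.exact r hr hS.epi_g).s_g⟩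
  · rintro ⟨s, hs⟩
    exact ⟨_, (ShortComplex.Splitting.ofExactOfSection S hS.exact s hs hS.mono_f).f_r⟩

/-- The pushout of a short exact sequence along a morphism out of its first object. -/
lemma CategoryTheory.ShortComplex.ShortExact.exists_pushout {S : ShortComplex C}
    (hS : S.ShortExact) {Y : C} (a : S.X₁ ⟶ Y) :
    ∃ (E : C) (q : S.X₂ ⟶ E) (f : Y ⟶ E) (g : E ⟶ S.X₃) (w : f ≫ g = 0),
      (ShortComplex.mk f g w).ShortExact ∧ IsPushout S.f a q f ∧ q ≫ g = S.g := by
  have := hS.mono_f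
  have := hS.epi_g
  let g : pushout S.f a ⟶ S.X₃ := pushout.desc S.g 0 (by simp)
  have hg : pushout.inl S.f a ≫ g = S.g := pushout.inl_desc _ _ _
  have w : pushout.inr S.f a ≫ g = 0 := pushout.inr_desc _ _ _
  refine ⟨_, _, _, g, w, ?_, IsPushout.of_hasPushout S.f a, hg⟩
  have : Epi g := epi_of_epi_fac hg
  refine { exact := ?_, mono_f := inferInstanceAs (Mono (pushout.inr S.f a)), epi_g := this }
  refine ShortComplex.exact_of_g_is_cokernel _ (CokernelCofork.IsColimit.ofπ g w
    (fun k hk => hS.exact.desc (pushout.inl S.f a ≫ k) ?_) ?_ ?_)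
  · rw [pushout.condition_assoc, hk, comp_zero]
  · intro Z k hk
    apply pushout.hom_ext
    · rw [reassoc_of% hg]; exact hS.exact.g_desc _ _
    · simp [reassoc_of% w, hk]
  · intro Z k hk m hm
    rw [← cancel_epi g, hm]
    apply pushout.hom_ext
    · rw [reassoc_of% hg]; exact (hS.exact.g_desc _ _).symm
    · simp [reassoc_of% w, hk]

namespace ExtensionsSplit

lemma exists_section {X Y : C} (h : ExtensionsSplit X Y) {E : C} (f : Y ⟶ E) (g : E ⟶ X)
    (w : f ≫ g = 0) (hS : (ShortComplex.mk f g w).ShortExact) : ∃ s : X ⟶ E, s ≫ g = 𝟙 X :=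
  (ShortComplex.ShortExact.exists_retraction_iff_exists_section hS).1 (h f g w hS)

lemma of_exists_section {X Y : C}
    (h : ∀ ⦃E : C⦄ (f : Y ⟶ E) (g : E ⟶ X) (w : f ≫ g = 0),
      (ShortComplex.mk f g w).ShortExact → ∃ s : X ⟶ E, s ≫ g = 𝟙 X) : ExtensionsSplit X Y :=
  fun _ f g w hS =>
    (ShortComplex.ShortExact.exists_retraction_iff_exists_section hS).2 (h f g w hS)

lemma op {X Y : C} (h : ExtensionsSplit X Y) :
    ExtensionsSplit (Opposite.op Y) (Opposite.op X) := by
  intro E f g w hS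
  obtain ⟨s, hs⟩ := h.exists_section g.unop f.unop _ hS.unop
  exact ⟨s.op, Quiver.Hom.unop_inj hs⟩

lemma unop {X Y : Cᵒᵖ} (h : ExtensionsSplit X Y) : ExtensionsSplit Y.unop X.unop := by
  intro E f g w hS
  obtain ⟨s, hs⟩ := h.exists_section g.op f.op _ hS.op
  exact ⟨s.unop, Quiver.Hom.op_inj hs⟩

lemma of_injective (X Y : C) [Injective Y] : ExtensionsSplit X Y := fun _ f _ _ hS =>
  have : Mono f := hS.mono_f
  ⟨Injective.factorThru (𝟙 Y) f, by simp⟩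

lemma of_projective (X Y : C) [Projective X] : ExtensionsSplit X Y :=
  of_exists_section fun _ _ g _ hS =>
    have : Epi g := hS.epi_g
    ⟨Projective.factorThru (𝟙 X) g, by simp⟩

lemma of_iso_right {X Y Y' : C} (h : ExtensionsSplit X Y) (e : Y ≅ Y') : ExtensionsSplit X Y' := by
  intro E f g w hS
  have w' : (e.hom ≫ f) ≫ g = 0 := by simp [w]
  obtain ⟨r, hr⟩ := h (e.hom ≫ f) g w' (ShortComplex.shortExact_of_iso
    (S₁ := ShortComplex.mk f g w) (S₂ := ShortComplex.mk (e.hom ≫ f) g w')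
    (ShortComplex.isoMk e.symm (Iso.refl _) (Iso.refl _)) hS)
  refine ⟨r ≫ e.hom, ?_⟩
  rw [← cancel_epi e.hom]
  simpa using hr =≫ e.hom

lemma of_iso_left {X X' Y : C} (h : ExtensionsSplit X Y) (e : X ≅ X') : ExtensionsSplit X' Y :=
  (h.op.of_iso_right e.symm.op).unop

/-- The obstruction to extending `a` is the pushout of `S` along `a`; a retraction of that extension
yields the required map. -/
lemma exists_extension {S : ShortComplex C} {Y : C} (h : ExtensionsSplit S.X₃ Y)
    (hS : S.ShortExact) (a : S.X₁ ⟶ Y) : ∃ b : S.X₂ ⟶ Y, S.f ≫ b = a := by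
  obtain ⟨E, q, f, g, w, hE, sq, -⟩ := hS.exists_pushout a
  obtain ⟨r, hr⟩ := h f g w hE
  exact ⟨q ≫ r, by rw [sq.w_assoc, hr, Category.comp_id]⟩

lemma exists_lift {S : ShortComplex C} {X : C} (h : ExtensionsSplit X S.X₁)
    (hS : S.ShortExact) (a : X ⟶ S.X₃) : ∃ b : X ⟶ S.X₂, b ≫ S.g = a := by
  obtain ⟨b, hb⟩ := h.op.exists_extension hS.op a.op
  exact ⟨b.unop, Quiver.Hom.op_inj hb⟩

/-- With an injective middle term, Ext¹(X, S.X₁) is the cokernel of Hom(X, S.X₂) → Hom(X, S.X₃). -/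
lemma of_exists_lift {S : ShortComplex C} {X : C} (hS : S.ShortExact) [Injective S.X₂]
    (h : ∀ a : X ⟶ S.X₃, ∃ b : X ⟶ S.X₂, b ≫ S.g = a) : ExtensionsSplit X S.X₁ := by
  intro E f g w hE
  have := hS.mono_f
  have : Mono f := hE.mono_f
  have : Epi g := hE.epi_g
  let e := Injective.factorThru S.f f
  have he : f ≫ e = S.f := Injective.comp_factorThru _ _
  have hfe : f ≫ e ≫ S.g = 0 := by rw [reassoc_of% he, S.zero]
  obtain ⟨b, hb⟩ := h (hE.exact.desc (e ≫ S.g) hfe)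
  have hd : g ≫ hE.exact.desc (e ≫ S.g) hfe = e ≫ S.g := hE.exact.g_desc _ _
  -- Subtracting `g ≫ b` makes `e` land in `S.X₁` without changing its restriction to `Y`.
  refine ⟨hS.exact.lift (e - g ≫ b) (by simp [hb, hd]), ?_⟩
  rw [← cancel_mono S.f, Category.assoc, hS.exact.lift_f]
  simp [he, reassoc_of% w]

/-- Vanishing of `Ext¹(-, Y)` is stable under extensions. -/
lemma of_shortExact [EnoughInjectives C] {S : ShortComplex C} {Y : C} (hS : S.ShortExact)
    (h₁ : ExtensionsSplit S.X₁ Y) (h₃ : ExtensionsSplit S.X₃ Y) : ExtensionsSplit S.X₂ Y := by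
  let T := ShortComplex.mk (Injective.ι Y) (cokernel.π (Injective.ι Y)) (by simp)
  have hT : T.ShortExact :=
    { exact := ShortComplex.exact_cokernel _
      mono_f := inferInstanceAs (Mono (Injective.ι Y))
      epi_g := inferInstanceAs (Epi (cokernel.π (Injective.ι Y))) }
  have : Injective T.X₂ := inferInstanceAs (Injective (Injective.under Y))
  have := hS.mono_f
  have := hS.epi_g
  refine of_exists_lift (S := T) hT fun a => ?_
  obtain ⟨b, hb⟩ := exists_lift (S := T) h₁ hT (S.f ≫ a)
  -- The lift over `S.X₁` extends to `S.X₂` by injectivity; the error then factors through `S.X₃`,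
  -- where it can be lifted too.
  let e : S.X₂ ⟶ T.X₂ := Injective.factorThru b S.f
  have he : S.f ≫ e = b := Injective.comp_factorThru _ _
  have h0 : S.f ≫ (a - e ≫ T.g) = 0 := by simp [reassoc_of% he, hb]
  obtain ⟨c, hc⟩ := exists_lift (S := T) h₃ hT (hS.exact.desc _ h0)
  exact ⟨e + S.g ≫ c, by simp [hc]⟩

lemma of_shortExact_right [EnoughProjectives C] {S : ShortComplex C} {X : C} (hS : S.ShortExact)
    (h₁ : ExtensionsSplit X S.X₁) (h₃ : ExtensionsSplit X S.X₃) : ExtensionsSplit X S.X₂ :=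
  (of_shortExact hS.op h₃.op h₁.op).unop

end ExtensionsSplit

/-- The long exact sequence gives both directions: the obstruction to a retraction is a class in
Ext¹, and every class is the image of a map from the kernel of a projective cover of `X`, which
extends and so gives zero. -/
lemma extOneVanishes_iff [EnoughProjectives C] (X Y : C) :
    ExtOneVanishes X Y ↔ ExtensionsSplit X Y := by
  have : HasExt.{v} C := hasExt_of_enoughProjectives.{v} C
  change Subsingleton (Abelian.Ext.{v} X Y 1) ↔ _
  constructor
  · intro _ E f g w hS
    obtain ⟨x, hx⟩ := Abelian.Ext.contravariant_sequence_exact₁ hS Y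
      (Abelian.Ext.mk₀ (𝟙 Y)) (add_zero 1) (Subsingleton.elim _ _)
    obtain ⟨r, rfl⟩ := Abelian.Ext.homEquiv₀.symm.surjective x
    refine ⟨r, Abelian.Ext.homEquiv₀.symm.injective ?_⟩
    simpa using hx
  · intro h
    let S := ShortComplex.mk (kernel.ι (Projective.π X)) (Projective.π X) (by simp)
    have hS : S.ShortExact :=
      { exact := ShortComplex.exact_kernel _
        mono_f := inferInstanceAs (Mono (kernel.ι (Projective.π X)))
        epi_g := inferInstanceAs (Epi (Projective.π X)) }
    have : Projective S.X₂ := inferInstanceAs (Projective (Projective.over X))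
    refine subsingleton_of_forall_eq 0 fun e => ?_
    obtain ⟨x, rfl⟩ := Abelian.Ext.contravariant_sequence_exact₃ hS Y e
      (Abelian.Ext.eq_zero_of_projective _) (add_zero 1)
    obtain ⟨a, rfl⟩ := Abelian.Ext.homEquiv₀.symm.surjective x
    obtain ⟨b, rfl⟩ := ExtensionsSplit.exists_extension (S := S) h hS a
    have : Abelian.Ext.mk₀ (S.f ≫ b) =
      (Abelian.Ext.mk₀ S.f).comp (Abelian.Ext.mk₀ b) (add_zero 0) := by simp
    change hS.extClass.comp (Abelian.Ext.mk₀ (S.f ≫ b)) _ = 0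
    rw [this, ShortComplex.ShortExact.extClass_comp_assoc]

end Extensions

/-! ### Acyclic objects and first derived functors. -/

section Acyclic

variable {C : Type u₁} [Category.{v₁} C] [Abelian C] {D : Type u₂} [Category.{v₂} D]

/-- `F` preserves the monomorphism of every short exact sequence with third object `X`. For a
right exact `F` this means that the first left derived functor of `F` vanishes at `X`. -/
def LeftAcyclic (F : C ⥤ D) (X : C) : Prop :=
  ∀ ⦃B E : C⦄ (f : B ⟶ E) (g : E ⟶ X) (w : f ≫ g = 0),
    (ShortComplex.mk f g w).ShortExact → Mono (F.map f)

/-- `G` preserves the epimorphism of every short exact sequence with first object `Y`. For a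
left exact `G` this means that the first right derived functor of `G` vanishes at `Y`. -/
def RightAcyclic (G : C ⥤ D) (Y : C) : Prop :=
  ∀ ⦃E Q : C⦄ (f : Y ⟶ E) (g : E ⟶ Q) (w : f ≫ g = 0),
    (ShortComplex.mk f g w).ShortExact → Epi (G.map g)

lemma leftAcyclic_of_preservesMonomorphisms (F : C ⥤ D) [F.PreservesMonomorphisms] (X : C) :
    LeftAcyclic F X := fun _ _ f _ _ hS =>
  have : Mono f := hS.mono_f
  inferInstance

lemma rightAcyclic_of_preservesEpimorphisms (G : C ⥤ D) [G.PreservesEpimorphisms] (Y : C) :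
    RightAcyclic G Y := fun _ _ _ g _ hS =>
  have : Epi g := hS.epi_g
  inferInstance

lemma leftAcyclic_op_iff (G : C ⥤ D) (Y : C) :
    LeftAcyclic G.op (Opposite.op Y) ↔ RightAcyclic G Y := by
  constructor
  · intro h E Q f g w hS
    have : Mono (G.map g).op := h g.op f.op _ hS.op
    exact unop_epi_of_mono (G.map g).op
  · intro h B E f g w hS
    have : Epi (G.map f.unop) := h g.unop f.unop _ hS.unop
    exact op_mono_of_epi (G.map f.unop)

lemma rightAcyclic_op_iff (F : C ⥤ D) (X : C) :
    RightAcyclic F.op (Opposite.op X) ↔ LeftAcyclic F X := by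
  constructor
  · intro h B E f g w hS
    have : Epi (F.map f).op := h g.op f.op _ hS.op
    exact unop_mono_of_epi (F.map f).op
  · intro h E Q f g w hS
    have : Mono (F.map g.unop) := h g.unop f.unop _ hS.unop
    exact op_epi_of_mono (F.map g.unop)

variable [Abelian D]

lemma LeftAcyclic.map_shortExact {F : C ⥤ D} [F.PreservesZeroMorphisms]
    [PreservesFiniteColimits F] {S : ShortComplex C} (h : LeftAcyclic F S.X₃)
    (hS : S.ShortExact) : (S.map F).ShortExact := by
  have := hS.epi_g
  exact
    { exact := hS.exact.map_of_epi_of_preservesCokernel F hS.epi_g inferInstance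
      mono_f := h S.f S.g S.zero hS
      epi_g := inferInstanceAs (Epi (F.map S.g)) }

lemma RightAcyclic.map_shortExact {G : C ⥤ D} [G.PreservesZeroMorphisms]
    [PreservesFiniteLimits G] {S : ShortComplex C} (h : RightAcyclic G S.X₁)
    (hS : S.ShortExact) : (S.map G).ShortExact := by
  have := hS.mono_f
  exact
    { exact := hS.exact.map_of_mono_of_preservesKernel G hS.mono_f inferInstance
      mono_f := inferInstanceAs (Mono (G.map S.f))
      epi_g := h S.f S.g S.zero hS }

/-- A morphism of short exact sequences which is the identity on third objects restricts to a
pushout square. -/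
lemma CategoryTheory.ShortComplex.ShortExact.isPushout {S T : ShortComplex C} (hS : S.ShortExact)
    (hT : T.ShortExact) (φ : S ⟶ T) [IsIso φ.τ₃] : IsPushout S.f φ.τ₁ φ.τ₂ T.f := by
  obtain ⟨E, q, f, g, w, hE, sq, hq⟩ := hS.exists_pushout φ.τ₁
  let ψ : ShortComplex.mk f g w ⟶ T :=
    { τ₁ := 𝟙 _
      τ₂ := sq.desc φ.τ₂ T.f φ.comm₁₂.symm
      τ₃ := φ.τ₃
      comm₁₂ := by simp
      comm₂₃ := by
        apply sq.hom_ext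
        · simpa [reassoc_of% hq] using φ.comm₂₃
        · simp [reassoc_of% w] }
  have : IsIso ψ.τ₁ := inferInstanceAs (IsIso (𝟙 _))
  have : IsIso ψ.τ₃ := inferInstanceAs (IsIso φ.τ₃)
  have : IsIso ψ.τ₂ := ShortComplex.isIso₂_of_shortExact_of_isIso₁₃ ψ hE hT
  exact sq.of_iso (Iso.refl _) (Iso.refl _) (Iso.refl _) (asIso ψ.τ₂) (by simp) (by simp)
    (by simp [ψ]) (by simp [ψ])

/-- Acyclicity with respect to a right exact functor can be tested on one projective
presentation. -/
lemma leftAcyclic_of_projective (F : C ⥤ D) [PreservesFiniteColimits F] {S : ShortComplex C}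
    (hS : S.ShortExact) [Projective S.X₂] [Mono (F.map S.f)] : LeftAcyclic F S.X₃ := by
  intro B E f g w hE
  have : Epi g := hE.epi_g
  have : Mono f := hE.mono_f
  have hq : Projective.factorThru S.g g ≫ g = S.g := Projective.factorThru_comp _ _
  let φ : S ⟶ ShortComplex.mk f g w :=
    { τ₁ := hE.exact.lift (S.f ≫ Projective.factorThru S.g g) (by simp)
      τ₂ := Projective.factorThru S.g g
      τ₃ := 𝟙 _
      comm₁₂ := hE.exact.lift_f _ _
      comm₂₃ := by simp }
  have : IsIso φ.τ₃ := inferInstanceAs (IsIso (𝟙 _))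
  -- A right exact functor keeps the pushout square, and monomorphisms in an abelian category are
  -- stable under pushout.
  have sq := (hS.isPushout hE φ).map F
  exact (MorphismProperty.monomorphisms D).of_isPushout sq.flip
    (MorphismProperty.monomorphisms.infer_property (F.map S.f))

/-- Acyclicity keeps the extension exact under `F`, so the counit extends along `F.map f`; its
transpose is a retraction. In effect Ext¹(X, G Y) embeds in Ext¹(F X, Y). -/
lemma ExtensionsSplit.rightAdjoint_obj {F : C ⥤ D} {G : D ⥤ C} [F.PreservesZeroMorphisms]
    (adj : F ⊣ G) {X : C} {Y : D} (h : ExtensionsSplit (F.obj X) Y) (hX : LeftAcyclic F X) :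
    ExtensionsSplit X (G.obj Y) := by
  have := adj.leftAdjoint_preservesColimits
  intro E f g w hS
  obtain ⟨b, hb⟩ : ∃ b : F.obj E ⟶ Y, F.map f ≫ b = adj.counit.app Y :=
    ExtensionsSplit.exists_extension (S := (ShortComplex.mk f g w).map F) h
      (LeftAcyclic.map_shortExact (S := ShortComplex.mk f g w) hX hS) (adj.counit.app Y)
  refine ⟨adj.homEquiv _ _ b, ?_⟩
  rw [← adj.homEquiv_naturality_left, hb]
  simp [adj.homEquiv_unit]

lemma ExtensionsSplit.leftAdjoint_obj {F : C ⥤ D} {G : D ⥤ C} [G.PreservesZeroMorphisms]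
    (adj : F ⊣ G) {X : C} {Y : D} (h : ExtensionsSplit X (G.obj Y)) (hY : RightAcyclic G Y) :
    ExtensionsSplit (F.obj X) Y :=
  have : G.op.PreservesZeroMorphisms := { map_zero := fun _ _ => Quiver.Hom.unop_inj (by simp) }
  (ExtensionsSplit.rightAdjoint_obj (F := G.op) (G := F.op) adj.op h.op
    ((leftAcyclic_op_iff G Y).2 hY)).unop

/-- The image of `a` is the kernel of `e`, and it equals the kernel of `b` precisely when `m` loses
nothing. Used with `K` the image under `F` of a syzygy. -/
lemma exact_iff_mono_of_epi {X₁ X₂ X₃ K : C} {a : X₁ ⟶ X₂} {b : X₂ ⟶ X₃} (hab : a ≫ b = 0)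
    {e : X₂ ⟶ K} {m : K ⟶ X₃} (fac : e ≫ m = b) (w : a ≫ e = 0)
    (h : (ShortComplex.mk a e w).Exact) [Epi e] : (ShortComplex.mk a b hab).Exact ↔ Mono m := by
  constructor
  · intro hS
    refine Preadditive.mono_of_cancel_zero _ fun {T} x hx => ?_
    obtain ⟨T₁, π, _, y, hy⟩ := surjective_up_to_refinements_of_epi e x
    obtain ⟨T₂, π', _, z, hz⟩ := hS.exact_up_to_refinements y (by
      change y ≫ b = 0
      rw [← fac, ← reassoc_of% hy, hx, comp_zero])
    change T₂ ⟶ X₁ at z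
    change π' ≫ y = z ≫ a at hz
    rw [← cancel_epi π, hy, comp_zero, ← cancel_epi π', reassoc_of% hz, w, comp_zero, comp_zero]
  · intro _
    rw [ShortComplex.exact_iff_exact_up_to_refinements]
    intro T y hy
    change T ⟶ X₂ at y
    change y ≫ b = 0 at hy
    exact h.exact_up_to_refinements y (by
      change y ≫ e = 0
      rw [← cancel_mono m, Category.assoc, fac, hy, zero_comp])

/-- Right exactness identifies the cokernel of `F.map a` with `F` of the kernel of `p`, so the
homology at `F.obj X₂` is the kernel of `F.map (kernel.ι p)`. -/
lemma exact_map_iff_leftAcyclic (F : C ⥤ D) [F.PreservesZeroMorphisms] [PreservesFiniteColimits F]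
    {X₃ X₂ X₁ X : C} {a : X₃ ⟶ X₂} {b : X₂ ⟶ X₁} {p : X₁ ⟶ X} (hab : a ≫ b = 0) (hbp : b ≫ p = 0)
    (hab' : (ShortComplex.mk a b hab).Exact) (hbp' : (ShortComplex.mk b p hbp).Exact)
    [Projective X₁] [hp : Epi p] :
    ((ShortComplex.mk a b hab).map F).Exact ↔ LeftAcyclic F X := by
  have fac : kernel.lift p b hbp ≫ kernel.ι p = b := kernel.lift_ι _ _ _
  have : Epi (kernel.lift p b hbp) := hbp'.epi_kernelLift
  have w : a ≫ kernel.lift p b hbp = 0 := by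
    rw [← cancel_mono (kernel.ι p), Category.assoc, fac, hab, zero_comp]
  have hS : (ShortComplex.mk a _ w).Exact := by
    rw [ShortComplex.exact_iff_exact_up_to_refinements]
    intro T y hy
    change T ⟶ X₂ at y
    change y ≫ kernel.lift p b hbp = 0 at hy
    exact hab'.exact_up_to_refinements y (by
      change y ≫ b = 0
      rw [← fac, reassoc_of% hy, zero_comp])
  let T := ShortComplex.mk (kernel.ι p) p (by simp)
  have hT : T.ShortExact :=
    { exact := ShortComplex.exact_kernel _
      mono_f := inferInstanceAs (Mono (kernel.ι p))
      epi_g := inferInstanceAs (Epi p) }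
  have : ((ShortComplex.mk a b hab).map F).Exact ↔ Mono (F.map (kernel.ι p)) :=
    exact_iff_mono_of_epi _ (by rw [← F.map_comp, fac]) (by rw [← F.map_comp, w, F.map_zero])
      (hS.map_of_epi_of_preservesCokernel F this inferInstance)
  rw [this]
  constructor
  · intro _
    have : Projective T.X₂ := inferInstanceAs (Projective X₁)
    have : Mono (F.map T.f) := inferInstanceAs (Mono (F.map (kernel.ι p)))
    exact leftAcyclic_of_projective F hT
  · intro h
    exact h _ _ _ hT

lemma exact_map_iff_rightAcyclic (G : C ⥤ D) [G.PreservesZeroMorphisms] [PreservesFiniteLimits G]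
    {X₃ X₂ X₁ X : C} {a : X₂ ⟶ X₃} {b : X₁ ⟶ X₂} {p : X ⟶ X₁} (hab : b ≫ a = 0) (hbp : p ≫ b = 0)
    (hab' : (ShortComplex.mk b a hab).Exact) (hbp' : (ShortComplex.mk p b hbp).Exact)
    [Injective X₁] [hp : Mono p] :
    ((ShortComplex.mk b a hab).map G).Exact ↔ RightAcyclic G X := by
  have := preservesFiniteColimits_op G
  have : G.op.PreservesZeroMorphisms := { map_zero := fun _ _ => Quiver.Hom.unop_inj (by simp) }
  rw [← leftAcyclic_op_iff, ← exact_map_iff_leftAcyclic G.op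
    (a := a.op) (b := b.op) (p := p.op) (by rw [← op_comp, hab, op_zero])
    (by rw [← op_comp, hbp, op_zero]) hab'.op hbp'.op]
  exact (ShortComplex.exact_op_iff ((ShortComplex.mk b a hab).map G)).symm

lemma isZero_leftDerived_one_iff [EnoughProjectives C] (F : C ⥤ D) [F.Additive]
    [PreservesFiniteColimits F] (X : C) :
    IsZero ((F.leftDerived 1).obj X) ↔ LeftAcyclic F X := by
  let P := projectiveResolution X
  have : Projective (P.complex.X 0) := P.projective 0
  have hp : Epi (P.π.f 0) := inferInstance
  rw [(P.isoLeftDerivedObj F 1).isZero_iff]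
  refine Iff.trans ?_ (exact_map_iff_leftAcyclic F (X := X) _ _ (P.exact_succ 0) P.exact₀ (hp := hp))
  refine (HomologicalComplex.exactAt_iff_isZero_homology _ _).symm.trans ?_
  exact HomologicalComplex.exactAt_iff' _ 2 1 0 (by simp) (by simp)

lemma isZero_rightDerived_one_iff [EnoughInjectives C] (G : C ⥤ D) [G.Additive]
    [PreservesFiniteLimits G] (Y : C) :
    IsZero ((G.rightDerived 1).obj Y) ↔ RightAcyclic G Y := by
  let I := injectiveResolution Y
  have : Injective (I.cocomplex.X 0) := I.injective 0
  have hp : Mono (I.ι.f 0) := inferInstance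
  rw [(I.isoRightDerivedObj G 1).isZero_iff]
  refine Iff.trans ?_ (exact_map_iff_rightAcyclic G (X := Y) _ _ (I.exact_succ 0) I.exact₀ (hp := hp))
  refine (HomologicalComplex.exactAt_iff_isZero_homology _ _).symm.trans ?_
  exact HomologicalComplex.exactAt_iff' _ 0 1 2 (by simp) (by simp)

end Acyclic

/-! ### Cotorsion pairs through splitting, with their duality. -/

section CotorsionPairs

variable {C : Type u} [Category.{v} C] [Abelian C]

/-- `P` and `Q` determine each other as orthogonals with respect to splitting of extensions. -/
structure IsSplitCotorsionPair (P Q : ObjectProperty C) : Prop where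
  right_iff (Y : C) : Q Y ↔ ∀ X, P X → ExtensionsSplit X Y
  left_iff (X : C) : P X ↔ ∀ Y, Q Y → ExtensionsSplit X Y

lemma isCotorsionPair_iff [EnoughProjectives C] (P Q : ObjectProperty C) :
    IsCotorsionPair P Q ↔ IsSplitCotorsionPair P Q := by
  constructor
  · rintro ⟨h₁, h₂⟩
    exact ⟨fun Y => by simp only [← extOneVanishes_iff]; exact iff_of_eq (congrFun h₁ Y).symm,
      fun X => by simp only [← extOneVanishes_iff]; exact iff_of_eq (congrFun h₂ X).symm⟩
  · rintro ⟨h₁, h₂⟩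
    simp only [← extOneVanishes_iff] at h₁ h₂
    exact ⟨funext fun Y => propext (h₁ Y).symm, funext fun X => propext (h₂ X).symm⟩

namespace IsSplitCotorsionPair

variable {P Q : ObjectProperty C}

lemma op (h : IsSplitCotorsionPair P Q) : IsSplitCotorsionPair Q.op P.op where
  right_iff Y := (h.left_iff Y.unop).trans
    ⟨fun H X hX => (H X.unop hX).op, fun H Y' hY' => (H (Opposite.op Y') hY').unop⟩
  left_iff X := (h.right_iff X.unop).trans
    ⟨fun H Y hY => (H Y.unop hY).op, fun H Y' hY' => (H (Opposite.op Y') hY').unop⟩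

lemma unop (h : IsSplitCotorsionPair Q.op P.op) : IsSplitCotorsionPair P Q where
  right_iff Y := (h.left_iff (Opposite.op Y)).trans
    ⟨fun H X hX => (H (Opposite.op X) hX).unop, fun H Y' hY' => (H Y'.unop hY').op⟩
  left_iff X := (h.right_iff (Opposite.op X)).trans
    ⟨fun H Y hY => (H (Opposite.op Y) hY).unop, fun H Y' hY' => (H Y'.unop hY').op⟩

lemma extensionsSplit (h : IsSplitCotorsionPair P Q) {X Y : C} (hX : P X) (hY : Q Y) :
    ExtensionsSplit X Y := (h.right_iff Y).1 hY X hX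

lemma left_of_iso (h : IsSplitCotorsionPair P Q) {X X' : C} (e : X ≅ X') (hX : P X) : P X' :=
  (h.left_iff X').2 fun _ hY => (h.extensionsSplit hX hY).of_iso_left e

lemma right_of_iso (h : IsSplitCotorsionPair P Q) {Y Y' : C} (e : Y ≅ Y') (hY : Q Y) : Q Y' :=
  (h.right_iff Y').2 fun _ hX => (h.extensionsSplit hX hY).of_iso_right e

lemma left_of_projective (h : IsSplitCotorsionPair P Q) (X : C) [Projective X] : P X :=
  (h.left_iff X).2 fun Y _ => ExtensionsSplit.of_projective X Y

lemma right_of_injective (h : IsSplitCotorsionPair P Q) (Y : C) [Injective Y] : Q Y :=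
  (h.right_iff Y).2 fun X _ => ExtensionsSplit.of_injective X Y

lemma left_of_isZero (h : IsSplitCotorsionPair P Q) {X : C} (hX : IsZero X) : P X :=
  have : Projective X := hX.projective
  h.left_of_projective X

lemma right_of_isZero (h : IsSplitCotorsionPair P Q) {Y : C} (hY : IsZero Y) : Q Y :=
  have : Injective Y := hY.injective
  h.right_of_injective Y

lemma left_of_shortExact [EnoughInjectives C] (h : IsSplitCotorsionPair P Q) {S : ShortComplex C}
    (hS : S.ShortExact) (h₁ : P S.X₁) (h₃ : P S.X₃) : P S.X₂ :=
  (h.left_iff _).2 fun _ hY =>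
    .of_shortExact hS (h.extensionsSplit h₁ hY) (h.extensionsSplit h₃ hY)

/-- If there are enough projectives, then special right approximations yield special left
approximations. -/
lemma isCompletePair [EnoughProjectives C] [EnoughInjectives C] (h : IsSplitCotorsionPair P Q)
    (hr : ∀ M : C, ∃ (D₂ C₂ : C) (f : M ⟶ D₂) (g : D₂ ⟶ C₂) (w : f ≫ g = 0),
      (ShortComplex.mk f g w).ShortExact ∧ P C₂ ∧ Q D₂) : IsCompletePair P Q where
  exists_right := hr
  exists_left M := by
    let T := ShortComplex.mk (kernel.ι (Projective.π M)) (Projective.π M) (by simp)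
    have hT : T.ShortExact :=
      { exact := ShortComplex.exact_kernel _
        mono_f := inferInstanceAs (Mono (kernel.ι (Projective.π M)))
        epi_g := inferInstanceAs (Epi (Projective.π M)) }
    -- Salce's argument: the pushout of the projective cover and `D` under `T.X₁` is both an
    -- extension of `M` by `D` and an extension of `K` by a projective, hence in `P`.
    obtain ⟨D, K, f, g, w, hS, hK, hD⟩ := hr T.X₁
    obtain ⟨E, q, f', g', w', hE, sq, -⟩ := hT.exists_pushout f
    obtain ⟨E', q', f'', g'', w'', hE', sq', -⟩ := hS.exists_pushout T.f
    let e : E ≅ E' := sq.isoIsPushout _ _ sq'.flip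
    exact ⟨_, _, _, _, _, hE, h.left_of_iso e.symm (h.left_of_shortExact hE'
      (have : Projective T.X₂ := inferInstanceAs (Projective (Projective.over M))
       h.left_of_projective T.X₂) hK), hD⟩

/-- Dimension shifting: for `Y` in `Q` the cosyzygy of `Y` is again in `Q`. A map from `S.X₁` to it
therefore extends to `S.X₂`, and then lifts to the injective hull term because Ext¹(S.X₂, Y) = 0. -/
lemma isHereditaryPair [EnoughInjectives C] (h : IsSplitCotorsionPair P Q)
    (hQ : ∀ S : ShortComplex C, S.ShortExact → Q S.X₁ → Q S.X₂ → Q S.X₃) :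
    IsHereditaryPair P Q where
  cokernel_mem := hQ
  kernel_mem S hS h₂ h₃ := by
    refine (h.left_iff _).2 fun Y hY => ?_
    let T := ShortComplex.mk (Injective.ι Y) (cokernel.π (Injective.ι Y)) (by simp)
    have hT : T.ShortExact :=
      { exact := ShortComplex.exact_cokernel _
        mono_f := inferInstanceAs (Mono (Injective.ι Y))
        epi_g := inferInstanceAs (Epi (cokernel.π (Injective.ι Y))) }
    have : Injective T.X₂ := inferInstanceAs (Injective (Injective.under Y))
    refine ExtensionsSplit.of_exists_lift (S := T) hT fun a => ?_
    obtain ⟨b, rfl⟩ :=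
      (h.extensionsSplit h₃ (hQ T hT hY (h.right_of_injective _))).exists_extension hS a
    obtain ⟨c, rfl⟩ := ExtensionsSplit.exists_lift (S := T) (h.extensionsSplit h₂ hY) hT b
    exact ⟨S.f ≫ c, Category.assoc _ _ _⟩

end IsSplitCotorsionPair

lemma IsCompletePair.op {P Q : ObjectProperty C} (h : IsCompletePair P Q) :
    IsCompletePair Q.op P.op where
  exists_left M := by
    obtain ⟨D, K, f, g, w, hS, hK, hD⟩ := h.exists_right M.unop
    exact ⟨_, _, _, _, _, hS.op, hD, hK⟩
  exists_right M := by
    obtain ⟨D, K, f, g, w, hS, hK, hD⟩ := h.exists_left M.unop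
    exact ⟨_, _, _, _, _, hS.op, hD, hK⟩

lemma IsCompletePair.unop {P Q : ObjectProperty C} (h : IsCompletePair Q.op P.op) :
    IsCompletePair P Q where
  exists_left M := by
    obtain ⟨D, K, f, g, w, hS, hK, hD⟩ := h.exists_right (Opposite.op M)
    exact ⟨_, _, _, _, _, hS.unop, hD, hK⟩
  exists_right M := by
    obtain ⟨D, K, f, g, w, hS, hK, hD⟩ := h.exists_left (Opposite.op M)
    exact ⟨_, _, _, _, _, hS.unop, hD, hK⟩

lemma IsHereditaryPair.op {P Q : ObjectProperty C} (h : IsHereditaryPair P Q) :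
    IsHereditaryPair Q.op P.op where
  kernel_mem S hS h₂ h₃ := h.cokernel_mem S.unop hS.unop h₃ h₂
  cokernel_mem S hS h₁ h₂ := h.kernel_mem S.unop hS.unop h₂ h₁

lemma IsHereditaryPair.unop {P Q : ObjectProperty C} (h : IsHereditaryPair Q.op P.op) :
    IsHereditaryPair P Q where
  kernel_mem S hS h₂ h₃ := h.cokernel_mem S.op hS.op h₃ h₂
  cokernel_mem S hS h₁ h₂ := h.kernel_mem S.op hS.op h₂ h₁

lemma isCompleteHereditaryCotorsionPair_op_iff [EnoughProjectives C] [EnoughInjectives C]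
    (P Q : ObjectProperty C) :
    IsCompleteHereditaryCotorsionPair Q.op P.op ↔ IsCompleteHereditaryCotorsionPair P Q :=
  ⟨fun ⟨h₁, h₂, h₃⟩ => ⟨(isCotorsionPair_iff P Q).2 ((isCotorsionPair_iff Q.op P.op).1 h₁).unop,
    h₂.unop, h₃.unop⟩, fun ⟨h₁, h₂, h₃⟩ =>
    ⟨(isCotorsionPair_iff Q.op P.op).2 ((isCotorsionPair_iff P Q).1 h₁).op, h₂.op, h₃.op⟩⟩

end CotorsionPairs

/-! ### Recollements: duality, vanishing and exactness criteria. -/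

namespace Recollement

variable {A' : Type u₁} [Category.{v₁} A'] [Abelian A']
  {A : Type u₂} [Category.{v₂} A] [Abelian A]
  {A'' : Type u₃} [Category.{v₃} A''] [Abelian A'']

attribute [instance] iLowerStar_full iLowerStar_faithful jLowerShriek_full jLowerShriek_faithful
  jLowerStar_full jLowerStar_faithful

/-- The recollement of opposite categories, exchanging `i^*` with `i^!` and `j_!` with `j_*`. -/
def op (R : Recollement A' A A'') : Recollement A'ᵒᵖ Aᵒᵖ A''ᵒᵖ where
  iUpperStar := R.iUpperShriek.op
  iLowerStar := R.iLowerStar.op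
  iUpperShriek := R.iUpperStar.op
  jLowerShriek := R.jLowerStar.op
  jUpperStar := R.jUpperStar.op
  jLowerStar := R.jLowerShriek.op
  adj_iUpperStar_iLowerStar := R.adj_iLowerStar_iUpperShriek.op
  adj_iLowerStar_iUpperShriek := R.adj_iUpperStar_iLowerStar.op
  adj_jLowerShriek_jUpperStar := R.adj_jUpperStar_jLowerStar.op
  adj_jUpperStar_jLowerStar := R.adj_jLowerShriek_jUpperStar.op
  iLowerStar_full := inferInstance
  iLowerStar_faithful := inferInstance
  jLowerShriek_full := inferInstance
  jLowerShriek_faithful := inferInstance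
  jLowerStar_full := inferInstance
  jLowerStar_faithful := inferInstance
  isZero_jUpperStar_obj_iff X := by
    refine Iff.trans ⟨fun h => h.unop, fun h => h.op⟩
      ((R.isZero_jUpperStar_obj_iff X.unop).trans ⟨?_, ?_⟩)
    · rintro ⟨Y, ⟨e⟩⟩
      exact ⟨Opposite.op Y, ⟨e.symm.op⟩⟩
    · rintro ⟨Y, ⟨e⟩⟩
      exact ⟨Y.unop, ⟨e.symm.unop⟩⟩

variable (R : Recollement A' A A'')

instance : PreservesFiniteColimits R.iUpperStar :=
  have := R.adj_iUpperStar_iLowerStar.leftAdjoint_preservesColimits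
  inferInstance

instance : PreservesFiniteColimits R.iLowerStar :=
  have := R.adj_iLowerStar_iUpperShriek.leftAdjoint_preservesColimits
  inferInstance

instance : PreservesFiniteColimits R.jLowerShriek :=
  have := R.adj_jLowerShriek_jUpperStar.leftAdjoint_preservesColimits
  inferInstance

instance : PreservesFiniteColimits R.jUpperStar :=
  have := R.adj_jUpperStar_jLowerStar.leftAdjoint_preservesColimits
  inferInstance

instance : PreservesFiniteLimits R.iUpperShriek :=
  have := R.adj_iLowerStar_iUpperShriek.rightAdjoint_preservesLimits
  inferInstance

instance : PreservesFiniteLimits R.iLowerStar :=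
  have := R.adj_iUpperStar_iLowerStar.rightAdjoint_preservesLimits
  inferInstance

instance : PreservesFiniteLimits R.jLowerStar :=
  have := R.adj_jUpperStar_jLowerStar.rightAdjoint_preservesLimits
  inferInstance

instance : PreservesFiniteLimits R.jUpperStar :=
  have := R.adj_jLowerShriek_jUpperStar.rightAdjoint_preservesLimits
  inferInstance

instance : R.iLowerStar.Additive := Functor.additive_of_preserves_binary_products _

instance : R.jUpperStar.Additive := Functor.additive_of_preserves_binary_products _

lemma isZero_jUpperStar_iLowerStar (X : A') : IsZero (R.jUpperStar.obj (R.iLowerStar.obj X)) :=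
  (R.isZero_jUpperStar_obj_iff _).2 (R.iLowerStar.obj_mem_essImage X)

lemma isZero_iUpperStar_jLowerShriek (Y : A'') :
    IsZero (R.iUpperStar.obj (R.jLowerShriek.obj Y)) := by
  rw [IsZero.iff_id_eq_zero]
  apply (R.adj_iUpperStar_iLowerStar.homEquiv _ _).injective
  apply (R.adj_jLowerShriek_jUpperStar.homEquiv _ _).injective
  exact (R.isZero_jUpperStar_iLowerStar _).eq_of_tgt _ _

lemma isZero_iUpperShriek_jLowerStar (Y : A'') :
    IsZero (R.iUpperShriek.obj (R.jLowerStar.obj Y)) :=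
  (R.op.isZero_iUpperStar_jLowerShriek (Opposite.op Y)).unop

/-- The canonical isomorphism `X ≅ i^! i_* X`. -/
noncomputable def isoUnitShriek (X : A') : X ≅ R.iUpperShriek.obj (R.iLowerStar.obj X) :=
  asIso (R.adj_iLowerStar_iUpperShriek.unit.app X)

/-- The canonical isomorphism `i^* i_* X ≅ X`. -/
noncomputable def isoCounitStar (X : A') : R.iUpperStar.obj (R.iLowerStar.obj X) ≅ X :=
  asIso (R.adj_iUpperStar_iLowerStar.counit.app X)

/-- The canonical isomorphism `Y ≅ j^* j_! Y`. -/
noncomputable def isoUnitJ (Y : A'') : Y ≅ R.jUpperStar.obj (R.jLowerShriek.obj Y) :=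
  asIso (R.adj_jLowerShriek_jUpperStar.unit.app Y)

/-- The canonical isomorphism `j^* j_* Y ≅ Y`. -/
noncomputable def isoCounitJ (Y : A'') : R.jUpperStar.obj (R.jLowerStar.obj Y) ≅ Y :=
  asIso (R.adj_jUpperStar_jLowerStar.counit.app Y)

/-- An object killed by j^* has the form i_* X', and i^* recovers X'. -/
lemma isZero_of_iUpperStar {X : A} (hj : IsZero (R.jUpperStar.obj X))
    (hi : IsZero (R.iUpperStar.obj X)) : IsZero X := by
  obtain ⟨X', ⟨e⟩⟩ := (R.isZero_jUpperStar_obj_iff X).1 hj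
  have : IsZero X' := hi.of_iso ((R.isoCounitStar X').symm ≪≫ R.iUpperStar.mapIso e)
  exact (R.iLowerStar.map_isZero this).of_iso e.symm

lemma isZero_of_iUpperShriek {X : A} (hj : IsZero (R.jUpperStar.obj X))
    (hi : IsZero (R.iUpperShriek.obj X)) : IsZero X :=
  (R.op.isZero_of_iUpperStar (X := Opposite.op X) hj.op hi.op).unop

section

variable [PreservesFiniteColimits R.iUpperShriek]

/-- Both functors are exact, so they commute with homology, and together they detect zero objects.
-/
lemma exact_of_iUpperShriek {S : ShortComplex A} (hj : (S.map R.jUpperStar).Exact)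
    (hi : (S.map R.iUpperShriek).Exact) : S.Exact := by
  rw [ShortComplex.exact_iff_isZero_homology] at hj hi ⊢
  exact R.isZero_of_iUpperShriek (hj.of_iso (S.mapHomologyIso R.jUpperStar).symm)
    (hi.of_iso (S.mapHomologyIso R.iUpperShriek).symm)

lemma mono_of_iUpperShriek {X Y : A} (f : X ⟶ Y) [Mono (R.jUpperStar.map f)]
    [Mono (R.iUpperShriek.map f)] : Mono f := by
  rw [← ShortComplex.exact_iff_mono (ShortComplex.mk (0 : X ⟶ X) f (by simp)) rfl]
  apply R.exact_of_iUpperShriek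
  · rw [ShortComplex.exact_iff_mono _ (R.jUpperStar.map_zero X X)]
    assumption
  · rw [ShortComplex.exact_iff_mono _ (R.iUpperShriek.map_zero X X)]
    assumption

lemma epi_of_iUpperShriek {X Y : A} (f : X ⟶ Y) [Epi (R.jUpperStar.map f)]
    [Epi (R.iUpperShriek.map f)] : Epi f := by
  rw [← ShortComplex.exact_iff_epi (ShortComplex.mk f (0 : Y ⟶ Y) (by simp)) rfl]
  apply R.exact_of_iUpperShriek
  · rw [ShortComplex.exact_iff_epi _ (R.jUpperStar.map_zero Y Y)]
    assumption
  · rw [ShortComplex.exact_iff_epi _ (R.iUpperShriek.map_zero Y Y)]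
    assumption

end

/-- The cokernel of j_* g is killed by j^*, since j^* j_* ≅ id, and by i^!, since its image there is
a quotient of i^! j_* Z = 0. -/
lemma preservesEpimorphisms_jLowerStar [R.iUpperShriek.PreservesEpimorphisms] :
    R.jLowerStar.PreservesEpimorphisms where
  preserves {Y Z} g _ := by
    refine Preadditive.epi_of_isZero_cokernel _ (R.isZero_of_iUpperShriek ?_ ?_)
    · have : Epi (R.jUpperStar.map (R.jLowerStar.map g)) := by
        have h : R.jUpperStar.map (R.jLowerStar.map g) =
            (R.isoCounitJ Y).hom ≫ g ≫ (R.isoCounitJ Z).inv := by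
          rw [← Category.assoc]
          exact (IsIso.eq_comp_inv _).2 (R.adj_jUpperStar_jLowerStar.counit.naturality g)
        rw [h]
        infer_instance
      have h : R.jUpperStar.map (cokernel.π (R.jLowerStar.map g)) = 0 := by
        rw [← cancel_epi (R.jUpperStar.map (R.jLowerStar.map g)), ← Functor.map_comp]
        simp
      exact IsZero.of_epi_eq_zero _ h
    · exact IsZero.of_epi (R.iUpperShriek.map (cokernel.π (R.jLowerStar.map g)))
        (R.isZero_iUpperShriek_jLowerStar Z)

lemma preservesMonomorphisms_jLowerShriek [R.iUpperStar.PreservesMonomorphisms] :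
    R.jLowerShriek.PreservesMonomorphisms where
  preserves {Y Z} f _ := by
    have : R.op.iUpperShriek.PreservesEpimorphisms :=
      ⟨fun g _ => op_epi_of_mono (R.iUpperStar.map g.unop)⟩
    have := R.op.preservesEpimorphisms_jLowerStar
    have : Epi (R.jLowerShriek.map f).op := inferInstanceAs (Epi (R.op.jLowerStar.map f.op))
    exact unop_mono_of_epi (R.jLowerShriek.map f).op

end Recollement

/-! ### Units, counits and iterated extensions, in preparation for gluing. -/

lemma CategoryTheory.Adjunction.isIso_map_counit_app {C : Type u₁} [Category.{v₁} C]
    {D : Type u₂} [Category.{v₂} D] {F : C ⥤ D} {G : D ⥤ C} (adj : F ⊣ G) [F.Full] [F.Faithful]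
    (Y : D) : IsIso (G.map (adj.counit.app Y)) := by
  have h := adj.right_triangle_components Y
  have : IsIso (adj.unit.app (G.obj Y) ≫ G.map (adj.counit.app Y)) := by
    rw [h]; exact inferInstanceAs (IsIso (𝟙 (G.obj Y)))
  exact IsIso.of_isIso_comp_left (adj.unit.app (G.obj Y)) _

lemma CategoryTheory.Adjunction.isIso_map_unit_app {C : Type u₁} [Category.{v₁} C]
    {D : Type u₂} [Category.{v₂} D] {F : C ⥤ D} {G : D ⥤ C} (adj : F ⊣ G) [G.Full] [G.Faithful]
    (X : C) : IsIso (F.map (adj.unit.app X)) := by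
  have h := adj.left_triangle_components X
  have : IsIso (F.map (adj.unit.app X) ≫ adj.counit.app (F.obj X)) := by
    rw [h]; exact inferInstanceAs (IsIso (𝟙 (F.obj X)))
  exact IsIso.of_isIso_comp_right _ (adj.counit.app (F.obj X))

/-- The cokernel of a composition of monomorphisms is the middle term of the extension obtained by
pushing out the second cokernel sequence. -/
lemma CategoryTheory.ShortComplex.ShortExact.comp_of_isPushout {C : Type u} [Category.{v} C]
    [Abelian C] {X E W Y Z : C} {f : X ⟶ E} {g : E ⟶ Y} {w : f ≫ g = 0}
    (hE : (ShortComplex.mk f g w).ShortExact) {f' : E ⟶ W} [Mono f'] {q : W ⟶ Z} {k : Y ⟶ Z}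
    (sq : IsPushout f' g q k) :
    ∃ w' : (f ≫ f') ≫ q = 0, (ShortComplex.mk (f ≫ f') q w').ShortExact := by
  have : Epi g := hE.epi_g
  have : Mono f := hE.mono_f
  have w' : (f ≫ f') ≫ q = 0 := by rw [Category.assoc, sq.w, reassoc_of% w, zero_comp]
  have : Epi q := (MorphismProperty.epimorphisms C).of_isPushout sq
    (MorphismProperty.epimorphisms.infer_property g)
  refine ⟨w', { exact := ?_, mono_f := inferInstanceAs (Mono (f ≫ f')), epi_g := this }⟩
  have hd {T : C} (t : W ⟶ T) (ht : (f ≫ f') ≫ t = 0) : f ≫ f' ≫ t = 0 := by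
    rw [← Category.assoc, ht]
  refine ShortComplex.exact_of_g_is_cokernel _ (CokernelCofork.IsColimit.ofπ q w'
    (fun t ht => sq.desc t (hE.exact.desc (f' ≫ t) (hd t ht))
      (hE.exact.g_desc _ (hd t ht)).symm) ?_ ?_)
  · intro T t ht
    exact sq.inl_desc _ _ _
  · intro T t ht m hm
    rw [← cancel_epi q, hm, sq.inl_desc]

/-! ### The glued cotorsion pair. -/

namespace Recollement

variable {A' : Type u₁} [Category.{v₁} A'] [Abelian A']
  {A : Type u₂} [Category.{v₂} A] [Abelian A]
  {A'' : Type u₃} [Category.{v₃} A''] [Abelian A''] (R : Recollement A' A A'')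

/-- An object is acyclic for `i^*` as soon as its extensions by the `i_* I` with `I` injective
split. -/
lemma leftAcyclic_iUpperStar [EnoughInjectives A'] {Z : A}
    (h : ∀ I : A', Injective I → ExtensionsSplit Z (R.iLowerStar.obj I)) :
    LeftAcyclic R.iUpperStar Z := by
  intro B E f g w hS
  -- Extending the transpose of `ι` along `f` and transposing back factors the monomorphism `ι`
  -- through i^* f.
  let ι := Injective.ι (R.iUpperStar.obj B)
  obtain ⟨b, hb⟩ := (h (Injective.under (R.iUpperStar.obj B)) inferInstance).exists_extension hS
    (R.adj_iUpperStar_iLowerStar.homEquiv _ _ ι)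
  change f ≫ b = _ at hb
  have : R.iUpperStar.map f ≫ (R.adj_iUpperStar_iLowerStar.homEquiv _ _).symm b = ι := by
    rw [← Adjunction.homEquiv_naturality_left_symm, hb, Equiv.symm_apply_apply]
  exact mono_of_mono_fac this

/-- Since j^* kills i_* X, it inverts `g`; the inverse transposes to a section. -/
lemma extensionsSplit_jLowerShriek_iLowerStar (Y : A'') (X : A') :
    ExtensionsSplit (R.jLowerShriek.obj Y) (R.iLowerStar.obj X) := by
  refine ExtensionsSplit.of_exists_section fun E f g w hS => ?_
  have hS' := hS.map_of_exact R.jUpperStar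
  have : IsIso (R.jUpperStar.map g) :=
    (ShortComplex.ShortExact.isIso_g_iff hS').2 (R.isZero_jUpperStar_iLowerStar X)
  refine ⟨(R.adj_jLowerShriek_jUpperStar.homEquiv _ _).symm
    (R.adj_jLowerShriek_jUpperStar.unit.app Y ≫ inv (R.jUpperStar.map g)), ?_⟩
  rw [← Adjunction.homEquiv_naturality_right_symm]
  simp [Adjunction.homEquiv_counit]

lemma leftAcyclic_iUpperStar_jLowerShriek [EnoughInjectives A'] (Y : A'') :
    LeftAcyclic R.iUpperStar (R.jLowerShriek.obj Y) :=
  R.leftAcyclic_iUpperStar fun I _ => R.extensionsSplit_jLowerShriek_iLowerStar Y I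

/-- For injective I, Ext¹(i_* X, i_* I) embeds in Ext¹(X, i^! i_* I) ≅ Ext¹(X, I) = 0. -/
lemma leftAcyclic_iUpperStar_iLowerStar [EnoughInjectives A']
    [R.iUpperShriek.PreservesEpimorphisms] (X : A') :
    LeftAcyclic R.iUpperStar (R.iLowerStar.obj X) :=
  R.leftAcyclic_iUpperStar fun I _ =>
    ((ExtensionsSplit.of_injective X I).of_iso_right (R.isoUnitShriek I)).leftAdjoint_obj
      R.adj_iLowerStar_iUpperShriek (rightAcyclic_of_preservesEpimorphisms _ _)

/-- The canonical short exact sequence `0 → i_* i^! Z → Z → j_* j^* Z → 0` when `i^!` is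
exact. -/
lemma shortExact_iLowerStar_jLowerStar [PreservesFiniteColimits R.iUpperShriek] (Z : A) :
    ∃ w, (ShortComplex.mk (R.adj_iLowerStar_iUpperShriek.counit.app Z)
      (R.adj_jUpperStar_jLowerStar.unit.app Z) w).ShortExact := by
  have w : R.adj_iLowerStar_iUpperShriek.counit.app Z ≫ R.adj_jUpperStar_jLowerStar.unit.app Z = 0 :=
    (R.adj_jUpperStar_jLowerStar.homEquiv _ _).symm.injective
      ((R.isZero_jUpperStar_iLowerStar _).eq_of_src _ _)
  -- Exactness is tested after j^* and i^!: the first kills the left term and inverts the unit, the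
  -- second kills the right term and inverts the counit.
  have := R.adj_iLowerStar_iUpperShriek.isIso_map_counit_app Z
  have := R.adj_jUpperStar_jLowerStar.isIso_map_unit_app Z
  have hj := R.isZero_jUpperStar_iLowerStar (R.iUpperShriek.obj Z)
  have hi := R.isZero_iUpperShriek_jLowerStar (R.jUpperStar.obj Z)
  have : Mono (R.jUpperStar.map (R.adj_iLowerStar_iUpperShriek.counit.app Z)) :=
    ⟨fun _ _ _ => hj.eq_of_tgt _ _⟩
  have : Epi (R.iUpperShriek.map (R.adj_jUpperStar_jLowerStar.unit.app Z)) :=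
    ⟨fun _ _ _ => hi.eq_of_src _ _⟩
  exact ⟨w,
    { exact := R.exact_of_iUpperShriek
        ((ShortComplex.exact_iff_mono _ (hj.eq_of_src _ _)).2
          (inferInstanceAs (Mono (R.jUpperStar.map (R.adj_jUpperStar_jLowerStar.unit.app Z)))))
        ((ShortComplex.exact_iff_epi _ (hi.eq_of_tgt _ _)).2
          (inferInstanceAs (Epi (R.iUpperShriek.map
            (R.adj_iLowerStar_iUpperShriek.counit.app Z)))))
      mono_f := R.mono_of_iUpperShriek _
      epi_g := R.epi_of_iUpperShriek _ }⟩

/-- The variant of `classM` in terms of `LeftAcyclic`. -/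
def acyclicM (X : ObjectProperty A') (Y : ObjectProperty A'') : ObjectProperty A :=
  fun Z => X (R.iUpperStar.obj Z) ∧ Y (R.jUpperStar.obj Z) ∧ LeftAcyclic R.iUpperStar Z

/-- The variant of `classN` in terms of `RightAcyclic`. -/
def acyclicN (X : ObjectProperty A') (Y : ObjectProperty A'') : ObjectProperty A :=
  fun Z => X (R.iUpperShriek.obj Z) ∧ Y (R.jUpperStar.obj Z) ∧ RightAcyclic R.iUpperShriek Z

lemma classM_eq [EnoughProjectives A] (X : ObjectProperty A') (Y : ObjectProperty A'') :
    R.classM X Y = R.acyclicM X Y := by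
  ext Z
  simp only [classM, acyclicM, isZero_leftDerived_one_iff]

lemma classN_eq [EnoughInjectives A] (X : ObjectProperty A') (Y : ObjectProperty A'') :
    R.classN X Y = R.acyclicN X Y := by
  ext Z
  simp only [classN, acyclicN, isZero_rightDerived_one_iff]

lemma op_acyclicM (X : ObjectProperty A') (Y : ObjectProperty A'') :
    R.op.acyclicM X.op Y.op = (R.acyclicN X Y).op := by
  ext Z
  exact and_congr Iff.rfl (and_congr Iff.rfl (leftAcyclic_op_iff _ _))

lemma op_acyclicN (X : ObjectProperty A') (Y : ObjectProperty A'') :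
    R.op.acyclicN X.op Y.op = (R.acyclicM X Y).op := by
  ext Z
  exact and_congr Iff.rfl (and_congr Iff.rfl (rightAcyclic_op_iff _ _))

variable {U' V' : ObjectProperty A'} {U'' V'' : ObjectProperty A''}

lemma acyclicM_jLowerShriek [EnoughInjectives A']
    (h' : IsSplitCotorsionPair U' V') (h'' : IsSplitCotorsionPair U'' V'')
    {Y : A''} (hY : U'' Y) :
    R.acyclicM U' U'' (R.jLowerShriek.obj Y) :=
  ⟨h'.left_of_isZero (R.isZero_iUpperStar_jLowerShriek Y),
    h''.left_of_iso (R.isoUnitJ Y) hY, R.leftAcyclic_iUpperStar_jLowerShriek Y⟩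

section

variable [PreservesFiniteColimits R.iUpperShriek]

lemma acyclicN_iLowerStar
    (h' : IsSplitCotorsionPair U' V') (h'' : IsSplitCotorsionPair U'' V'')
    {X : A'} (hX : V' X) : R.acyclicN V' V'' (R.iLowerStar.obj X) :=
  ⟨h'.right_of_iso (R.isoUnitShriek X) hX,
    h''.right_of_isZero (R.isZero_jUpperStar_iLowerStar X),
    rightAcyclic_of_preservesEpimorphisms _ _⟩

lemma acyclicN_jLowerStar
    (h' : IsSplitCotorsionPair U' V') (h'' : IsSplitCotorsionPair U'' V'')
    {Y : A''} (hY : V'' Y) : R.acyclicN V' V'' (R.jLowerStar.obj Y) :=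
  ⟨h'.right_of_isZero (R.isZero_iUpperShriek_jLowerStar Y),
    h''.right_of_iso (R.isoCounitJ Y).symm hY, rightAcyclic_of_preservesEpimorphisms _ _⟩

lemma acyclicM_iLowerStar [EnoughInjectives A']
    (h' : IsSplitCotorsionPair U' V') (h'' : IsSplitCotorsionPair U'' V'')
    {X : A'} (hX : U' X) :
    R.acyclicM U' U'' (R.iLowerStar.obj X) :=
  ⟨h'.left_of_iso (R.isoCounitStar X).symm hX,
    h''.left_of_isZero (R.isZero_jUpperStar_iLowerStar X),
    R.leftAcyclic_iUpperStar_iLowerStar X⟩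

/-- Orthogonality passes through the two ends of the canonical sequence of `W`. Acyclicity of `Z`
serves the i_* end; for the j_* end exactness of j^* suffices. -/
lemma extensionsSplit_of_acyclicM_of_acyclicN [EnoughProjectives A]
    (h' : IsSplitCotorsionPair U' V') (h'' : IsSplitCotorsionPair U'' V'')
    {Z W : A}
    (hZ : R.acyclicM U' U'' Z) (hW : R.acyclicN V' V'' W) : ExtensionsSplit Z W := by
  have := R.preservesEpimorphisms_jLowerStar
  obtain ⟨w, hS⟩ := R.shortExact_iLowerStar_jLowerStar W
  refine ExtensionsSplit.of_shortExact_right hS ?_ ?_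
  · exact (h'.extensionsSplit hZ.1 hW.1).rightAdjoint_obj R.adj_iUpperStar_iLowerStar hZ.2.2
  · exact (h''.extensionsSplit hZ.2.1 hW.2.1).rightAdjoint_obj R.adj_jUpperStar_jLowerStar
      (leftAcyclic_of_preservesMonomorphisms _ _)

/-- Each defining condition is recovered by transposing extensions against one family of test
objects. Only the family j_! U'' needs `hj`, because j_! need not be exact. -/
lemma isSplitCotorsionPair [EnoughInjectives A'] [EnoughProjectives A]
    (h' : IsSplitCotorsionPair U' V') (h'' : IsSplitCotorsionPair U'' V'')
    (hj : ∀ Y, U'' Y → LeftAcyclic R.jLowerShriek Y) :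
    IsSplitCotorsionPair (R.acyclicM U' U'') (R.acyclicN V' V'') where
  right_iff W := by
    refine ⟨fun hW Z hZ => R.extensionsSplit_of_acyclicM_of_acyclicN h' h'' hZ hW,
      fun h => ⟨(h'.right_iff _).2 fun X hX => ?_, (h''.right_iff _).2 fun Y hY => ?_,
        rightAcyclic_of_preservesEpimorphisms _ _⟩⟩
    · exact (h _ (R.acyclicM_iLowerStar h' h'' hX)).rightAdjoint_obj
        R.adj_iLowerStar_iUpperShriek (leftAcyclic_of_preservesMonomorphisms _ _)
    · exact (h _ (R.acyclicM_jLowerShriek h' h'' hY)).rightAdjoint_obj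
        R.adj_jLowerShriek_jUpperStar (hj Y hY)
  left_iff Z := by
    have := R.preservesEpimorphisms_jLowerStar
    refine ⟨fun hZ W hW => R.extensionsSplit_of_acyclicM_of_acyclicN h' h'' hZ hW,
      fun h => ⟨(h'.left_iff _).2 fun X hX => ?_, (h''.left_iff _).2 fun Y hY => ?_,
        R.leftAcyclic_iUpperStar fun I _ =>
          h _ (R.acyclicN_iLowerStar h' h'' (h'.right_of_injective I))⟩⟩
    · exact (h _ (R.acyclicN_iLowerStar h' h'' hX)).leftAdjoint_obj
        R.adj_iUpperStar_iLowerStar (rightAcyclic_of_preservesEpimorphisms _ _)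
    · exact (h _ (R.acyclicN_jLowerStar h' h'' hY)).leftAdjoint_obj
        R.adj_jUpperStar_jLowerStar (rightAcyclic_of_preservesEpimorphisms _ _)

end

/-- Special right approximations in a recollement with `i^!` exact, glued from those of the
outer terms. -/
lemma exists_right_approximation [EnoughInjectives A'] [EnoughProjectives A] [EnoughInjectives A]
    [PreservesFiniteColimits R.iUpperShriek]
    (h' : IsSplitCotorsionPair U' V') (h'' : IsSplitCotorsionPair U'' V'')
    (c' : IsCompletePair U' V') (c'' : IsCompletePair U'' V'')
    (hj : ∀ Y, U'' Y → LeftAcyclic R.jLowerShriek Y) (X : A) :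
    ∃ (W Z : A) (f : X ⟶ W) (g : W ⟶ Z) (w : f ≫ g = 0),
      (ShortComplex.mk f g w).ShortExact ∧ R.acyclicM U' U'' Z ∧ R.acyclicN V' V'' W := by
  -- First pushout: 0 → X → E → j_! Y₂ → 0 with j^* E ≅ Y₁, because j^* inverts the counit j_! j^* X
  -- → X.
  obtain ⟨Y₁, Y₂, a, b, wab, hab, hY₂, hY₁⟩ := c''.exists_right (R.jUpperStar.obj X)
  obtain ⟨E, q, f, g, w, hE, sq, -⟩ :=
    (LeftAcyclic.map_shortExact (F := R.jLowerShriek) (hj Y₂ hY₂) hab).exists_pushout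
      (R.adj_jLowerShriek_jUpperStar.counit.app X)
  -- Second pushout: 0 → E → W → i_* X₂ → 0 with i^! W ≅ X₁. It leaves j^* unchanged, as j^* i_* =
  -- 0.
  obtain ⟨X₁, X₂, a', b', wab', hab', hX₂, hX₁⟩ := c'.exists_right (R.iUpperShriek.obj E)
  obtain ⟨W, q', f', g', w', hW, sq', -⟩ :=
    (hab'.map_of_exact R.iLowerStar).exists_pushout (R.adj_iLowerStar_iUpperShriek.counit.app E)
  change R.jLowerShriek.obj Y₁ ⟶ E at q
  have sq₁ : IsPushout (R.jLowerShriek.map a) (R.adj_jLowerShriek_jUpperStar.counit.app X) q f := sq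
  have : IsIso (R.jUpperStar.map q) :=
    have := R.adj_jLowerShriek_jUpperStar.isIso_map_counit_app X
    (sq₁.map R.jUpperStar).isIso_inl_of_isIso
  change R.iLowerStar.obj X₁ ⟶ W at q'
  have sq₁' : IsPushout (R.iLowerStar.map a') (R.adj_iLowerStar_iUpperShriek.counit.app E) q' f' :=
    sq'
  have : IsIso (R.iUpperShriek.map q') :=
    have := R.adj_iLowerStar_iUpperShriek.isIso_map_counit_app E
    (sq₁'.map R.iUpperShriek).isIso_inl_of_isIso
  have : IsIso (R.jUpperStar.map f') := by
    have := (hW.map_of_exact R.jUpperStar).isIso_f_iff.2 (R.isZero_jUpperStar_iLowerStar X₂)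
    exact this
  have hM := R.isSplitCotorsionPair h' h'' hj
  have : Mono f := hE.mono_f
  have : Mono f' := hW.mono_f
  -- The cokernel of X → W is an extension of i_* X₂ by j_! Y₂, both in M.
  obtain ⟨Z, q₂, k, l, wkl, hZ, sq₂, -⟩ := hW.exists_pushout g
  obtain ⟨w₂, h₂⟩ := hE.comp_of_isPushout sq₂
  refine ⟨W, Z, f ≫ f', q₂, w₂, h₂, ?_, ?_, ?_, ?_⟩
  · exact hM.left_of_shortExact hZ (R.acyclicM_jLowerShriek h' h'' hY₂)
      (R.acyclicM_iLowerStar h' h'' hX₂)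
  · exact h'.right_of_iso (R.isoUnitShriek X₁ ≪≫ asIso (R.iUpperShriek.map q')) hX₁
  · exact h''.right_of_iso (R.isoUnitJ Y₁ ≪≫ asIso (R.jUpperStar.map q) ≪≫
      asIso (R.jUpperStar.map f')) hY₁
  · exact rightAcyclic_of_preservesEpimorphisms _ _

theorem isCompleteHereditaryCotorsionPair_acyclic [EnoughInjectives A'] [EnoughProjectives A']
    [EnoughProjectives A] [EnoughInjectives A] [EnoughProjectives A'']
    [PreservesFiniteColimits R.iUpperShriek]
    (h' : IsCompleteHereditaryCotorsionPair U' V')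
    (h'' : IsCompleteHereditaryCotorsionPair U'' V'')
    (hj : ∀ Y, U'' Y → LeftAcyclic R.jLowerShriek Y) :
    IsCompleteHereditaryCotorsionPair (R.acyclicM U' U'') (R.acyclicN V' V'') := by
  have hs' := (isCotorsionPair_iff U' V').1 h'.isCotorsionPair
  have hs'' := (isCotorsionPair_iff U'' V'').1 h''.isCotorsionPair
  have hs := R.isSplitCotorsionPair hs' hs'' hj
  refine ⟨(isCotorsionPair_iff _ _).2 hs,
    hs.isCompletePair (R.exists_right_approximation hs' hs'' h'.isComplete h''.isComplete hj),
    hs.isHereditaryPair fun S hS h₁ h₂ => ⟨?_, ?_, rightAcyclic_of_preservesEpimorphisms _ _⟩⟩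
  · exact h'.isHereditary.cokernel_mem _ (hS.map_of_exact R.iUpperShriek) h₁.1 h₂.1
  · exact h''.isHereditary.cokernel_mem _ (hS.map_of_exact R.jUpperStar) h₁.2.1 h₂.2.1

end Recollement

theorem corollary4p2
    {A' : Type u₁} [Category.{v₁} A'] [Abelian A'] [EnoughProjectives A'] [EnoughInjectives A']
    {A : Type u₂} [Category.{v₂} A] [Abelian A] [EnoughProjectives A] [EnoughInjectives A]
    {A'' : Type u₃} [Category.{v₃} A''] [Abelian A''] [EnoughProjectives A'']
    [EnoughInjectives A'']
    (R : Recollement A' A A'')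
    (U' V' : ObjectProperty A') (U'' V'' : ObjectProperty A'')
    (h' : IsCompleteHereditaryCotorsionPair U' V')
    (h'' : IsCompleteHereditaryCotorsionPair U'' V'')
    (h : (exactFunctor A A' R.iUpperShriek ∧
          ∀ Y : A'', U'' Y → IsZero ((R.jLowerShriek.leftDerived 1).obj Y)) ∨
        (exactFunctor A A' R.iUpperStar ∧
          ∀ Y : A'', V'' Y → IsZero ((R.jLowerStar.rightDerived 1).obj Y)) ∨
        (exactFunctor A A' R.iUpperShriek ∧ exactFunctor A A' R.iUpperStar)) :
    IsCompleteHereditaryCotorsionPair (R.classM U' U'') (R.classN V' V'') := by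
  rw [R.classM_eq, R.classN_eq]
  rcases h with ⟨⟨-, hi⟩, hj⟩ | ⟨⟨hi, -⟩, hj⟩ | ⟨⟨-, hi⟩, ⟨hi', -⟩⟩
  · have : PreservesFiniteColimits R.iUpperShriek := hi
    exact R.isCompleteHereditaryCotorsionPair_acyclic h' h''
      fun Y hY => (isZero_leftDerived_one_iff _ Y).1 (hj Y hY)
  · rw [← isCompleteHereditaryCotorsionPair_op_iff, ← R.op_acyclicM, ← R.op_acyclicN]
    have : PreservesFiniteLimits R.iUpperStar := hi
    have : PreservesFiniteColimits R.op.iUpperShriek := preservesFiniteColimits_op R.iUpperStar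
    exact R.op.isCompleteHereditaryCotorsionPair_acyclic
      ((isCompleteHereditaryCotorsionPair_op_iff _ _).2 h')
      ((isCompleteHereditaryCotorsionPair_op_iff _ _).2 h'')
      fun Y hY => (leftAcyclic_op_iff R.jLowerStar Y.unop).2
        ((isZero_rightDerived_one_iff _ _).1 (hj Y.unop hY))
  · have : PreservesFiniteColimits R.iUpperShriek := hi
    have : PreservesFiniteLimits R.iUpperStar := hi'
    -- Exactness of i^* makes j_! preserve monomorphisms, so every object is acyclic for j_!.
    have := R.preservesMonomorphisms_jLowerShriek
    exact R.isCompleteHereditaryCotorsionPair_acyclic h' h''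
      fun Y _ => leftAcyclic_of_preservesMonomorphisms _ Y
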